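/- **Graphs.** Let $\mathcal A\subseteq\mathbb R$ be a set of admissible attribute values (any set, e.g. a bounded one). A graph $g=(V_g,E_g,\mathrm{at}_g)$ consists of a finite node set $V_g\subset\{1,2,\dots\}$, a set of directed edges $E_g\subseteq V_g\times V_g$ without self-loops, and an attribute map $\mathrm{at}_g:V_g\cup E_g\to\mathcal A$ that is nonzero on edges. Two graphs are isomorphic if a bijection of their nodes preserves edges, non-edges and all attributes; $\mathcal G$ is the set of graphs up to isomorphism. A graph with $n$ nodes is represented by the matrix $A_g\in\mathbb R^{n\times n}$ indexed by $V_g$, with $(A_g)_{ii}=\mathrm{at}_g(i)$, $(A_g)_{ij}=\mathrm{at}_g((i,j))$ if $(i,j)\in E_g$, and $0$ otherwise. **Features.** The equality pattern of a multi-index $i=(i_1,\dots,i_m)$ is the partition of its positions in which $a$ and $b$ share a block iff $i_a=i_b$. For a partition $\gamma$ of $k$ positions let $I_\gamma\in\mathbb R^{n^k}$ be the indicator tensor of the multi-indices with pattern $\gamma$, and put $I_\gamma T=\sum_i (I_\gamma)_iT_i$ for an order-$k$ tensor $T$. For a partition $\gamma$ of $k+2$ positions put $(E_\gamma A)_i=\sum_{j_1,j_2}\mathbf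 1[(i_1,\dots,i_k,j_1,j_2)\text{ has pattern }\gamma]\,A_{j_1j_2}$. Define $$F_{2,k}(A;\theta_F)=\sum_\gamma\theta_\gamma E_\gamma A+\sum_{\gamma'}\theta'_{\gamma'}I_{\gamma'},\qquad H_k(T;\theta_H)=\sum_\gamma\theta_\gamma I_\gamma T+\theta_0'.$$ The parameter space $\mathcal W$ is the set of all $w=(k,\theta_F,\theta_H)$ with $k\ge1$ an integer, $\theta_F\in\mathbb R^{\mathrm{Bell}(k+2)+\mathrm{Bell}(k)}$ and $\theta_H\in\mathbb R^{\mathrm{Bell}(k)+1}$, with the disjoint-union topology and its Borel $\sigma$-algebra. Given $\rho_i,\rho_e:\mathbb R\to\mathbb R$, set $\psi(g;w)=\rho_i\big(H_k(\rho_e(F_{2,k}(A_g;\theta_F));\theta_H)\big)$, with $\rho_e$ applied componentwise. **Theorem.** Let $P$ be a probability distribution on $\mathcal W$ and assume: 1. $\rho_i$ and $\rho_e$ are continuous, $\rho_i$ is non-constant, and $\rho_e$ is squashing, i.e. non-decreasing with $\rho_e(x)\to0$ as $x\to-\infty$ and $\rho_e(x)\to1$ as $x\to+\infty$; 2. $\operatorname{supp}(P)=\mathcal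 W$; 3. there is a constant $C>0$ such that $\mathbb E_{w\sim P}[\psi(g;w)^4]<C$ for every graph $g$. Then $(\psi(g_1;w)-\psi(g_2;w))^2$ is $P$-integrable for all graphs $g_1,g_2$, and $$d_P(g_1,g_2)=\Big(\mathbb E_{w\sim P}\big[(\psi(g_1;w)-\psi(g_2;w))^2\big]\Big)^{1/2}$$ is a well-defined metric on $\mathcal G$. In particular, $d_P(g_1,g_2)>0$ if and only if $g_1$ and $g_2$ are non-isomorphic. -/

import Mathlib

open Filter Topology MeasureTheory

noncomputable section

namespace GRNF

/-! ### Attributed graphs -/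

/-- A finite directed attributed graph without self-loops: a finite set `V` of nodes, which are
positive integers, a set of edges inside `V × V`, and an attribute map on nodes and edges with
values in the set `𝒜` of admissible attributes. An edge attribute is nonzero, since `0` encodes
the absence of an edge in the representation of the graph by a matrix. -/
structure AttrGraph (𝒜 : Set ℝ) where
  V : Finset ℕ+
  E : Set (V × V)
  loopless : ∀ i : V, (i, i) ∉ E
  nodeAttr : V → ℝ
  edgeAttr : E → ℝ
  nodeAttr_mem : ∀ i, nodeAttr i ∈ 𝒜
  edgeAttr_mem : ∀ e, edgeAttr e ∈ 𝒜
  edgeAttr_ne_zero : ∀ e, edgeAttr e ≠ 0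

/-- Two attributed graphs are isomorphic if some bijection of the nodes preserves and reflects
edges and preserves the attributes of nodes and edges. -/
def Isomorphic {𝒜 : Set ℝ} (g h : AttrGraph 𝒜) : Prop :=
  ∃ e : g.V ≃ h.V,
    (∀ i, h.nodeAttr (e i) = g.nodeAttr i) ∧
    (∀ i j, (e i, e j) ∈ h.E ↔ (i, j) ∈ g.E) ∧
    (∀ (i j : g.V) (hg : (i, j) ∈ g.E) (hh : (e i, e j) ∈ h.E),
      h.edgeAttr ⟨(e i, e j), hh⟩ = g.edgeAttr ⟨(i, j), hg⟩)

theorem Isomorphic.refl {𝒜 : Set ℝ} (g : AttrGraph 𝒜) : Isomorphic g g :=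
  ⟨Equiv.refl _, fun _ => rfl, fun _ _ => Iff.rfl, fun _ _ _ _ => rfl⟩

theorem Isomorphic.symm {𝒜 : Set ℝ} {g h : AttrGraph 𝒜} (H : Isomorphic g h) :
    Isomorphic h g := by
  obtain ⟨e, h1, h2, h3⟩ := H
  refine ⟨e.symm, fun i => ?_, fun i j => ?_, fun i j hg hh => ?_⟩
  · rw [← h1, e.apply_symm_apply]
  · rw [← h2, e.apply_symm_apply, e.apply_symm_apply]
  · obtain ⟨i, rfl⟩ := e.surjective i
    obtain ⟨j, rfl⟩ := e.surjective j
    simp only [e.symm_apply_apply] at hh ⊢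
    exact (h3 i j hh hg).symm

theorem Isomorphic.trans {𝒜 : Set ℝ} {g h k : AttrGraph 𝒜} (H : Isomorphic g h)
    (K : Isomorphic h k) : Isomorphic g k := by
  obtain ⟨e, h1, h2, h3⟩ := H
  obtain ⟨f, k1, k2, k3⟩ := K
  refine ⟨e.trans f, fun i => ?_, fun i j => ?_, fun i j hg hh => ?_⟩
  · exact (k1 (e i)).trans (h1 i)
  · exact (k2 (e i) (e j)).trans (h2 i j)
  · exact (k3 (e i) (e j) ((h2 i j).2 hg) hh).trans (h3 i j hg _)

instance graphSetoid (𝒜 : Set ℝ) : Setoid (AttrGraph 𝒜) where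
  r := Isomorphic
  iseqv := ⟨Isomorphic.refl, Isomorphic.symm, Isomorphic.trans⟩

/-- The space of graphs: nodes are not identified, so graphs are taken up to isomorphism. -/
def GraphSpace (𝒜 : Set ℝ) : Type := Quotient (graphSetoid 𝒜)

/-! ### Tensors, and affine equivariant and invariant maps -/

/-- Real tensors of order `k` with every mode indexed by `V`. -/
abbrev Tensor (V : Type*) (k : ℕ) : Type _ := (Fin k → V) → ℝ

open scoped Classical in
/-- The matrix of a graph, as a tensor of order two: node attributes on the diagonal, edge
attributes at the edges, and zeros elsewhere. Its size is the number of nodes of the graph. -/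
def AttrGraph.adjTensor {𝒜 : Set ℝ} (g : AttrGraph 𝒜) : Tensor g.V 2 := fun i =>
  if i 0 = i 1 then g.nodeAttr (i 0)
  else if h : (i 0, i 1) ∈ g.E then g.edgeAttr ⟨(i 0, i 1), h⟩ else 0

/-- Partitions of a finite set, given as equivalence relations, are finite in number. -/
instance setoidFintype (α : Type*) [Finite α] : Fintype (Setoid α) :=
  have : Finite (Setoid α) :=
    Finite.of_injective (fun (r : Setoid α) (a b : α) => r a b) fun _ _ h =>
      Setoid.ext fun a b => iff_of_eq (congrFun (congrFun h a) b)
  Fintype.ofFinite _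

open scoped Classical in
/-- The invariant basis tensor of a partition `γ` of the modes: its entry at a multi-index `i` is
`1` if `γ` is the equality pattern of `i` (`i a = i b` exactly when `a` and `b` lie in the same
block of `γ`) and `0` otherwise. -/
def invBasis (V : Type*) {k : ℕ} (γ : Setoid (Fin k)) : Tensor V k :=
  fun i => if Setoid.ker i = γ then 1 else 0

/-- The invariant linear functional of `γ`: contraction with the invariant basis tensor. -/
def invMap {V : Type*} [Fintype V] {k : ℕ} (γ : Setoid (Fin k)) (T : Tensor V k) : ℝ :=
  ∑ i, invBasis V γ i * T i

open scoped Classical in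
/-- The equivariant linear map of a partition `γ` of the `k + l` modes: contraction of `T` along
the `l` input modes with the indicator tensor of the equality pattern `γ`. -/
def equivMap {V : Type*} [Fintype V] {l k : ℕ} (γ : Setoid (Fin k ⊕ Fin l)) (T : Tensor V l) :
    Tensor V k :=
  fun i => ∑ j : Fin l → V, (if Setoid.ker (Sum.elim i j) = γ then 1 else 0) * T j

/-- Coefficients of an affine equivariant map `F`: linear part and bias part. -/
abbrev EquivParams (l k : ℕ) : Type := (Setoid (Fin k ⊕ Fin l) → ℝ) × (Setoid (Fin k) → ℝ)

/-- Coefficients of an affine invariant map `H`: linear part and bias. -/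
abbrev InvParams (k : ℕ) : Type := (Setoid (Fin k) → ℝ) × ℝ

/-- The affine permutation-equivariant map `F_{l,k}( · ; θ)`. -/
def affEquiv {V : Type*} [Fintype V] {l k : ℕ} (θ : EquivParams l k) (T : Tensor V l) :
    Tensor V k :=
  fun i => (∑ γ, θ.1 γ * equivMap γ T i) + ∑ γ', θ.2 γ' * invBasis V γ' i

/-- The affine permutation-invariant map `H_k( · ; θ)`. -/
def affInv {V : Type*} [Fintype V] {k : ℕ} (θ : InvParams k) (T : Tensor V k) : ℝ :=
  (∑ γ, θ.1 γ * invMap γ T) + θ.2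

/-! ### Graph neural features -/

/-- The parameter space of all `w = (k, θ_F, θ_H)` with `k ≥ 1`. -/
def ParamSpace : Type := Σ k : ℕ+, EquivParams 2 (k : ℕ) × InvParams (k : ℕ)

/-- The topology of the disjoint union, over `k`, of the Euclidean spaces of coefficients. -/
instance : TopologicalSpace ParamSpace :=
  inferInstanceAs (TopologicalSpace (Σ k : ℕ+, EquivParams 2 (k : ℕ) × InvParams (k : ℕ)))

instance : MeasurableSpace ParamSpace := borel ParamSpace

instance : BorelSpace ParamSpace := ⟨rfl⟩

/-- The tensor order `k` of a parameter. -/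
def ParamSpace.k (w : ParamSpace) : ℕ := (Sigma.fst w : ℕ+)

/-- The coefficients `θ_F` of a parameter. -/
def ParamSpace.θF (w : ParamSpace) : EquivParams 2 w.k := (Sigma.snd w).1

/-- The coefficients `θ_H` of a parameter. -/
def ParamSpace.θH (w : ParamSpace) : InvParams w.k := (Sigma.snd w).2

/-- The graph neural feature `ψ(g; w) = ρᵢ (H_k (ρₑ (F_{2,k} (A_g; θ_F)); θ_H))`, where the
activation function `ρₑ` is applied componentwise. -/
def feature (ρi ρe : ℝ → ℝ) {𝒜 : Set ℝ} (g : AttrGraph 𝒜) (w : ParamSpace) : ℝ :=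
  ρi (affInv w.θH (fun i => ρe (affEquiv w.θF g.adjTensor i)))

/-- The graph distance `d_P`. -/
def graphDist (ρi ρe : ℝ → ℝ) (P : Measure ParamSpace) {𝒜 : Set ℝ} (g₁ g₂ : AttrGraph 𝒜) : ℝ :=
  √(∫ w, (feature ρi ρe g₁ w - feature ρi ρe g₂ w) ^ 2 ∂P)

/-- A squashing function is non-decreasing with limits `0` at `-∞` and `1` at `+∞`. -/
def IsSquashing (ρ : ℝ → ℝ) : Prop :=
  Monotone ρ ∧ Tendsto ρ atBot (𝓝 0) ∧ Tendsto ρ atTop (𝓝 1)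

end GRNF

end

open Filter Topology MeasureTheory

namespace GRNF

/-! ### Separation of finite families of vectors by a squashing function -/

/-! The fourth moment puts each feature `ψ(g; ·)` in `L²(P)`, and `d_P` is the `L²` distance pulled
back along `g ↦ ψ(g; ·)`. Everything thus reduces to this map having exactly the isomorphism classes
as fibres. Features are continuous in `w` and `P` has full support, so equality almost everywhere is
equality everywhere (`feature_eq_of_ae_eq`), and a single separating parameter suffices
(`exists_feature_ne`).

Take `k` to be the larger number of nodes and coefficients that only see injective multi-indices.
The input of `ρi` is then an affine function of the sum, over embeddings of `Fin k` into the nodes,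
of `ρe` of a ridge function of the matrix entries so reindexed. If the sizes differ, the smaller
graph gives an empty sum. If they agree, the embeddings are the orderings of the nodes, and
non-isomorphic graphs have no reordered matrix in common. A vector of largest norm among all these
matrices is then cut off by a hyperplane from the family of the other graph, and a steep ridge
function along it makes the sums differ (`exists_ridge_sum_ne`). -/

theorem IsSquashing.nonneg {ρ : ℝ → ℝ} (h : IsSquashing ρ) (x : ℝ) : 0 ≤ ρ x :=
  h.1.le_of_tendsto h.2.1 x

/-- Expand `‖v - u‖² > 0`. A vector of maximal norm is thus strictly exposed by its own linear
functional. -/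
theorem sum_mul_lt_of_sum_sq_le {α : Type*} [Fintype α] {u v : α → ℝ}
    (hle : ∑ c, u c * u c ≤ ∑ c, v c * v c) (hne : v ≠ u) :
    ∑ c, v c * u c < ∑ c, v c * v c := by
  obtain ⟨c₀, hc₀⟩ := Function.ne_iff.1 hne
  have hpos : 0 < ∑ c, (v c - u c) ^ 2 :=
    Finset.sum_pos' (fun _ _ => sq_nonneg _)
      ⟨c₀, Finset.mem_univ _, sq_pos_of_ne_zero (sub_ne_zero.2 hc₀)⟩
  have hexp : ∑ c, (v c - u c) ^ 2
      = ∑ c, v c * v c - 2 * ∑ c, v c * u c + ∑ c, u c * u c := by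
    rw [Finset.mul_sum, ← Finset.sum_sub_distrib, ← Finset.sum_add_distrib]
    exact Finset.sum_congr rfl fun c _ => by ring
  linarith

/-- If a vector of the first family dominates the second family in norm, and the families have no
vector in common, then a ridge function in the direction of that vector separates the sums. -/
theorem exists_ridge_sum_lt {α ι κ : Type*} [Fintype α] [Fintype ι] [Fintype κ] {ρ : ℝ → ℝ}
    (hρ : IsSquashing ρ) (x : ι → α → ℝ) (y : κ → α → ℝ) (hxy : ∀ i j, x i ≠ y j) (i₀ : ι)
    (hmax : ∀ j, ∑ c, y j c * y j c ≤ ∑ c, x i₀ c * x i₀ c) :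
    ∃ (t : α → ℝ) (b : ℝ),
      ∑ j, ρ (∑ c, t c * y j c + b) < ∑ i, ρ (∑ c, t c * x i c + b) := by
  set v := x i₀ with hv
  have hlt : ∀ j, ∑ c, v c * y j c < ∑ c, v c * v c := fun j =>
    sum_mul_lt_of_sum_sq_le (hmax j) (hxy i₀ j)
  -- Finitely many strict gaps leave room for a threshold: the shifted functional is `δ > 0` at `v`
  -- and negative at every `y j`.
  obtain ⟨δ, hδ, hδlt⟩ : ∃ δ > 0, ∀ j, ∑ c, v c * y j c - ∑ c, v c * v c + δ < 0 := by
    have hev : ∀ᶠ δ in 𝓝[>] (0 : ℝ), ∀ j, ∑ c, v c * y j c - ∑ c, v c * v c + δ < 0 :=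
      eventually_all.2 fun j => by
        filter_upwards [Ioo_mem_nhdsGT (sub_pos.2 (hlt j))] with δ h
        linarith [h.2]
    obtain ⟨δ, h, h'⟩ := (hev.and self_mem_nhdsWithin).exists
    exact ⟨δ, h', h⟩
  have harg : ∀ (l : ℝ) (u : α → ℝ),
      ∑ c, l * v c * u c + l * (δ - ∑ c, v c * v c)
        = l * (∑ c, v c * u c - ∑ c, v c * v c + δ) := by
    intro l u
    have : ∑ c, l * v c * u c = l * ∑ c, v c * u c := by
      rw [Finset.mul_sum]
      exact Finset.sum_congr rfl fun c _ => by ring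
    rw [this]
    ring
  have hy : Tendsto (fun l : ℝ => ∑ j, ρ (l * (∑ c, v c * y j c - ∑ c, v c * v c + δ)))
      atTop (𝓝 0) := by
    have := tendsto_finsetSum (Finset.univ : Finset κ) fun j _ =>
      hρ.2.1.comp (tendsto_id.atTop_mul_const_of_neg (hδlt j))
    simpa using this
  have hx : Tendsto (fun l : ℝ => ρ (l * δ)) atTop (𝓝 1) :=
    hρ.2.2.comp (tendsto_id.atTop_mul_const hδ)
  -- As the slope `l` grows the ridge becomes a step: the `y` sum tends to `0`, the term of `i₀` to
  -- `1`, and the other `x` terms are nonnegative.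
  obtain ⟨l, hl⟩ := (hy.eventually_lt hx zero_lt_one).exists
  refine ⟨fun c => l * v c, l * (δ - ∑ c, v c * v c), ?_⟩
  simp only [harg]
  refine hl.trans_le ?_
  have hsingle := Finset.single_le_sum
    (f := fun i => ρ (l * (∑ c, v c * x i c - ∑ c, v c * v c + δ)))
    (fun i _ => hρ.nonneg _) (Finset.mem_univ i₀)
  simpa [← hv] using hsingle

/-- Ridge functions built from a squashing function separate the sums over two nonempty finite
families of vectors that have no vector in common. -/
theorem exists_ridge_sum_ne {α ι κ : Type*} [Fintype α] [Fintype ι] [Fintype κ] [Nonempty ι]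
    [Nonempty κ] {ρ : ℝ → ℝ} (hρ : IsSquashing ρ) (x : ι → α → ℝ) (y : κ → α → ℝ)
    (hxy : ∀ i j, x i ≠ y j) :
    ∃ (t : α → ℝ) (b : ℝ),
      ∑ i, ρ (∑ c, t c * x i c + b) ≠ ∑ j, ρ (∑ c, t c * y j c + b) := by
  obtain ⟨i₀, hi₀⟩ := Finite.exists_max fun i => ∑ c, x i c * x i c
  obtain ⟨j₀, hj₀⟩ := Finite.exists_max fun j => ∑ c, y j c * y j c
  rcases le_total (∑ c, y j₀ c * y j₀ c) (∑ c, x i₀ c * x i₀ c) with h | h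
  · obtain ⟨t, b, htb⟩ := exists_ridge_sum_lt hρ x y hxy i₀ fun j => (hj₀ j).trans h
    exact ⟨t, b, htb.ne'⟩
  · obtain ⟨t, b, htb⟩ := exists_ridge_sum_lt hρ y x (fun j i => (hxy i j).symm) j₀
      fun i => (hi₀ i).trans h
    exact ⟨t, b, htb.ne⟩

/-! ### Affine maps supported on the discrete pattern -/

theorem ker_eq_bot_iff_injective {α β : Type*} (f : α → β) :
    Setoid.ker f = ⊥ ↔ Function.Injective f :=
  Setoid.injective_iff_ker_bot f |>.symm

theorem invMap_bot {V : Type*} [Fintype V] {k : ℕ} (T : Tensor V k) :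
    invMap ⊥ T = ∑ i : Fin k ↪ V, T i := by
  classical
  simp only [invMap, invBasis, ker_eq_bot_iff_injective, ite_mul, one_mul, zero_mul]
  rw [← Finset.sum_filter]
  symm
  refine Finset.sum_bij (fun i _ => ⇑i) ?_ ?_ ?_ ?_
  · intro i _
    simpa using i.injective
  · intro i _ j _ h
    exact DFunLike.coe_injective h
  · intro f hf
    exact ⟨⟨f, (Finset.mem_filter.1 hf).2⟩, Finset.mem_univ _, rfl⟩
  · intro i _
    rfl

/-- The pattern in which the `l` input modes are tied to the output modes by `c`, and the output
modes are pairwise distinct. -/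
def tiePattern {k l : ℕ} (c : Fin l → Fin k) : Setoid (Fin k ⊕ Fin l) :=
  Setoid.ker (Sum.elim id c)

/-- Each input mode is tied to an output mode, so `i` determines `j`; the contraction then reads off
a single entry of the tensor. -/
theorem ker_sumElim_eq_tiePattern_iff {V : Type*} {k l : ℕ} {i : Fin k → V}
    (hi : Function.Injective i) (c : Fin l → Fin k) (j : Fin l → V) :
    Setoid.ker (Sum.elim i j) = tiePattern c ↔ j = i ∘ c := by
  constructor
  · intro h
    funext a
    have : Setoid.ker (Sum.elim i j) (Sum.inr a) (Sum.inl (c a)) := by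
      rw [h]
      rfl
    exact this
  · rintro rfl
    have : Sum.elim i (i ∘ c) = i ∘ Sum.elim id c := by
      funext a
      cases a <;> rfl
    ext a b
    rw [this]
    exact hi.eq_iff

theorem equivMap_tiePattern {V : Type*} [Fintype V] {k l : ℕ} {i : Fin k → V}
    (hi : Function.Injective i) (c : Fin l → Fin k) (T : Tensor V l) :
    equivMap (tiePattern c) T i = T (i ∘ c) := by
  classical
  simp [equivMap, ker_sumElim_eq_tiePattern_iff hi]

open scoped Classical in
/-- Coefficients for which the affine equivariant map, on multi-indices with distinct entries, is
the affine function of the selected entries with coefficients `t` and constant `b`. -/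
noncomputable def tieParams {k l : ℕ} (t : (Fin l → Fin k) → ℝ) (b : ℝ) : EquivParams l k :=
  -- Summing over `c` spares any appeal to injectivity of `tiePattern`.
  (fun γ => ∑ c, if γ = tiePattern c then t c else 0, fun γ => if γ = ⊥ then b else 0)

theorem affEquiv_tieParams {V : Type*} [Fintype V] {k l : ℕ} (t : (Fin l → Fin k) → ℝ) (b : ℝ)
    (T : Tensor V l) {i : Fin k → V} (hi : Function.Injective i) :
    affEquiv (tieParams t b) T i = ∑ c, t c * T (i ∘ c) + b := by
  classical
  have h1 : ∑ γ, (tieParams t b).1 γ * equivMap γ T i = ∑ c, t c * T (i ∘ c) := by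
    simp only [tieParams, Finset.sum_mul]
    rw [Finset.sum_comm]
    refine Finset.sum_congr rfl fun c _ => ?_
    simp [ite_mul, equivMap_tiePattern hi]
  have h2 : ∑ γ, (tieParams t b).2 γ * invBasis V γ i = b := by
    simp [tieParams, invBasis, (ker_eq_bot_iff_injective i).2 hi]
  rw [affEquiv, h1, h2]

open scoped Classical in
/-- Coefficients of the affine invariant map `T ↦ a * invMap ⊥ T + b`. -/
noncomputable def botParams (k : ℕ) (a b : ℝ) : InvParams k :=
  (fun γ => if γ = ⊥ then a else 0, b)

theorem affInv_botParams {V : Type*} [Fintype V] {k : ℕ} (a b : ℝ) (T : Tensor V k) :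
    affInv (botParams k a b) T = a * ∑ i : Fin k ↪ V, T i + b := by
  classical
  simp [affInv, botParams, ite_mul, invMap_bot]

/-! ### Invariance of the features under isomorphism -/

theorem ker_comp_of_injective {α β γ : Type*} {e : β → γ} (he : Function.Injective e) (f : α → β) :
    Setoid.ker (e ∘ f) = Setoid.ker f := by
  ext a b
  exact he.eq_iff

theorem invBasis_comp {V W : Type*} (e : V ≃ W) {k : ℕ} (γ : Setoid (Fin k)) (i : Fin k → V) :
    invBasis W γ (e ∘ i) = invBasis V γ i := by
  rw [invBasis, invBasis, ker_comp_of_injective e.injective]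

section Invariance

variable {V W : Type*} [Fintype V] [Fintype W]

theorem sum_tensor_comp (e : V ≃ W) {k : ℕ} (f : Tensor W k) :
    ∑ i : Fin k → V, f (e ∘ i) = ∑ i, f i :=
  Fintype.sum_equiv ((Equiv.refl (Fin k)).arrowCongr e) _ _ fun _ => rfl

theorem invMap_comp (e : V ≃ W) {k : ℕ} (γ : Setoid (Fin k)) (T : Tensor W k) :
    invMap γ (fun i : Fin k → V => T (e ∘ i)) = invMap γ T := by
  rw [invMap, invMap, ← sum_tensor_comp e]
  simp only [invBasis_comp]

theorem equivMap_comp (e : V ≃ W) {l k : ℕ} (γ : Setoid (Fin k ⊕ Fin l)) (T : Tensor W l)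
    (i : Fin k → V) :
    equivMap γ (fun j : Fin l → V => T (e ∘ j)) i = equivMap γ T (e ∘ i) := by
  rw [equivMap, equivMap, ← sum_tensor_comp e]
  refine Finset.sum_congr rfl fun j _ => ?_
  rw [← Sum.comp_elim, ker_comp_of_injective e.injective]

theorem affEquiv_comp (e : V ≃ W) {l k : ℕ} (θ : EquivParams l k) (T : Tensor W l)
    (i : Fin k → V) :
    affEquiv θ (fun j : Fin l → V => T (e ∘ j)) i = affEquiv θ T (e ∘ i) := by
  simp only [affEquiv, equivMap_comp, invBasis_comp]

theorem affInv_comp (e : V ≃ W) {k : ℕ} (θ : InvParams k) (T : Tensor W k) :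
    affInv θ (fun i : Fin k → V => T (e ∘ i)) = affInv θ T := by
  simp only [affInv, invMap_comp]

end Invariance

variable {𝒜 : Set ℝ}

/-- The matrix encodes the graph faithfully: without loops the diagonal holds only node attributes,
and since edge attributes are nonzero, an off-diagonal zero means a non-edge. -/
theorem isomorphic_of_adjTensor_comp {g h : AttrGraph 𝒜} (e : g.V ≃ h.V)
    (H : ∀ i, h.adjTensor (e ∘ i) = g.adjTensor i) : Isomorphic g h := by
  have hne : ∀ {g : AttrGraph 𝒜} {i j : g.V}, (i, j) ∈ g.E → i ≠ j := by
    rintro g i j hij rfl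
    exact g.loopless i hij
  have hedge : ∀ (g : AttrGraph 𝒜) {i j : g.V} (hij : (i, j) ∈ g.E),
      g.adjTensor ![i, j] = g.edgeAttr ⟨(i, j), hij⟩ := by
    intro g i j hij
    simp [AttrGraph.adjTensor, hne hij, hij]
  have hmem : ∀ (g : AttrGraph 𝒜) {i j : g.V}, i ≠ j →
      ((i, j) ∈ g.E ↔ g.adjTensor ![i, j] ≠ 0) := by
    intro g i j hij
    by_cases hE : (i, j) ∈ g.E
    · simp only [hE, hedge g hE, true_iff]
      exact g.edgeAttr_ne_zero _
    · simp [AttrGraph.adjTensor, hij, hE]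
  have hpair : ∀ i j, h.adjTensor ![e i, e j] = g.adjTensor ![i, j] := by
    intro i j
    rw [← H]
    congr 1
    funext a
    fin_cases a <;> rfl
  refine ⟨e, fun i => ?_, fun i j => ?_, fun i j hg hh => ?_⟩
  · simpa [AttrGraph.adjTensor] using hpair i i
  · rcases eq_or_ne i j with rfl | hij
    · exact iff_of_false (h.loopless _) (g.loopless _)
    · rw [hmem g hij, hmem h (e.injective.ne hij), hpair]
  · rw [← hedge g hg, ← hedge h hh, hpair]

theorem Isomorphic.exists_adjTensor_comp {g h : AttrGraph 𝒜} (H : Isomorphic g h) :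
    ∃ e : g.V ≃ h.V, ∀ i, h.adjTensor (e ∘ i) = g.adjTensor i := by
  obtain ⟨e, h1, h2, h3⟩ := H
  refine ⟨e, fun i => ?_⟩
  simp only [AttrGraph.adjTensor, Function.comp_apply, e.injective.eq_iff, h1]
  by_cases hE : (i 0, i 1) ∈ g.E
  · simp only [hE, (h2 _ _).2 hE, dite_true, h3 _ _ hE]
  · simp only [hE, mt (h2 _ _).1 hE, dite_false]

theorem feature_eq_of_isomorphic (ρi ρe : ℝ → ℝ) {g h : AttrGraph 𝒜} (H : Isomorphic g h) :
    feature ρi ρe g = feature ρi ρe h := by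
  obtain ⟨e, he⟩ := H.exists_adjTensor_comp
  funext w
  have hT : g.adjTensor = fun i => h.adjTensor (e ∘ i) := funext fun i => (he i).symm
  simp only [feature, hT, affEquiv_comp]
  rw [affInv_comp e w.θH fun i => ρe (affEquiv w.θF h.adjTensor i)]

/-! ### Non-isomorphic graphs are separated by a feature -/

theorem exists_tie_sum_ne_of_card_lt {ρe : ℝ → ℝ} (hsq : IsSquashing ρe) {g h : AttrGraph 𝒜}
    (hcard : Fintype.card g.V < Fintype.card h.V) :
    ∃ (k : ℕ+) (t : (Fin 2 → Fin k) → ℝ) (b : ℝ),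
      ∑ i : Fin k ↪ g.V, ρe (∑ c, t c * g.adjTensor (i ∘ c) + b) ≠
        ∑ i : Fin k ↪ h.V, ρe (∑ c, t c * h.adjTensor (i ∘ c) + b) := by
  obtain ⟨b, hb⟩ := (hsq.2.2.eventually (lt_mem_nhds zero_lt_one)).exists
  obtain ⟨k, hk⟩ : ∃ k : ℕ+, (k : ℕ) = Fintype.card h.V :=
    ⟨⟨Fintype.card h.V, (Nat.zero_le _).trans_lt hcard⟩, rfl⟩
  have hg : IsEmpty (Fin k ↪ g.V) :=
    Function.Embedding.isEmpty_of_card_lt (by rwa [Fintype.card_fin, hk])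
  have hh : Nonempty (Fin k ↪ h.V) := ⟨(Fintype.equivFinOfCardEq hk.symm).symm.toEmbedding⟩
  -- With `t = 0` every summand is the constant `ρe b > 0`, so only the number of embeddings
  -- matters.
  refine ⟨k, 0, b, ?_⟩
  rw [Fintype.sum_empty]
  refine (Finset.sum_pos (fun i _ => ?_) Finset.univ_nonempty).ne
  simpa using hb

theorem exists_tie_sum_ne_of_card_eq {ρe : ℝ → ℝ} (hsq : IsSquashing ρe) {g h : AttrGraph 𝒜}
    (hcard : Fintype.card g.V = Fintype.card h.V) (hiso : ¬ Isomorphic g h) :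
    ∃ (k : ℕ+) (t : (Fin 2 → Fin k) → ℝ) (b : ℝ),
      ∑ i : Fin k ↪ g.V, ρe (∑ c, t c * g.adjTensor (i ∘ c) + b) ≠
        ∑ i : Fin k ↪ h.V, ρe (∑ c, t c * h.adjTensor (i ∘ c) + b) := by
  -- Two empty graphs are isomorphic; excluding them gives the required `k ≥ 1`.
  have hpos : 0 < Fintype.card h.V := by
    by_contra h0
    have h0' : Fintype.card h.V = 0 := by omega
    have := Fintype.card_eq_zero_iff.1 h0'
    have := Fintype.card_eq_zero_iff.1 (hcard.trans h0')
    exact hiso (isomorphic_of_adjTensor_comp (Equiv.equivOfIsEmpty _ _) fun i => isEmptyElim (i 0))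
  have hg : Nonempty (Fin (Fintype.card h.V) ↪ g.V) :=
    ⟨(Fintype.equivFinOfCardEq hcard).symm.toEmbedding⟩
  have hh : Nonempty (Fin (Fintype.card h.V) ↪ h.V) := ⟨(Fintype.equivFin h.V).symm.toEmbedding⟩
  refine ⟨⟨Fintype.card h.V, hpos⟩, ?_⟩
  refine exists_ridge_sum_ne hsq
    (fun (i : Fin (Fintype.card h.V) ↪ g.V) (c : Fin 2 → Fin _) => g.adjTensor (i ∘ c))
    (fun (i : Fin (Fintype.card h.V) ↪ h.V) (c : Fin 2 → Fin _) => h.adjTensor (i ∘ c)) ?_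
  -- A common reordered matrix would make `j ∘ i⁻¹` an isomorphism.
  intro i j hij
  have hi : Function.Bijective i :=
    (Fintype.bijective_iff_injective_and_card i).2 ⟨i.injective, by simp [hcard]⟩
  have hj : Function.Bijective j :=
    (Fintype.bijective_iff_injective_and_card j).2 ⟨j.injective, by simp⟩
  refine hiso (isomorphic_of_adjTensor_comp
    ((Equiv.ofBijective i hi).symm.trans (Equiv.ofBijective j hj)) fun m => ?_)
  have hm : m = i ∘ ((Equiv.ofBijective i hi).symm ∘ m) := by
    funext a
    exact ((Equiv.ofBijective i hi).apply_symm_apply (m a)).symm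
  have := congrFun hij ((Equiv.ofBijective i hi).symm ∘ m)
  rw [hm]
  refine Eq.trans ?_ this.symm
  congr 1
  rw [← hm]
  rfl

theorem exists_feature_ne {ρi ρe : ℝ → ℝ} (hsq : IsSquashing ρe) (hnc : ∃ x y, ρi x ≠ ρi y)
    {g h : AttrGraph 𝒜} (hiso : ¬ Isomorphic g h) :
    ∃ w, feature ρi ρe g w ≠ feature ρi ρe h w := by
  obtain ⟨k, t, b, hne⟩ : ∃ (k : ℕ+) (t : (Fin 2 → Fin k) → ℝ) (b : ℝ),
      ∑ i : Fin k ↪ g.V, ρe (∑ c, t c * g.adjTensor (i ∘ c) + b) ≠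
        ∑ i : Fin k ↪ h.V, ρe (∑ c, t c * h.adjTensor (i ∘ c) + b) := by
    rcases lt_trichotomy (Fintype.card g.V) (Fintype.card h.V) with hlt | heq | hgt
    · exact exists_tie_sum_ne_of_card_lt hsq hlt
    · exact exists_tie_sum_ne_of_card_eq hsq heq hiso
    · obtain ⟨k, t, b, hne⟩ := exists_tie_sum_ne_of_card_lt hsq hgt
      exact ⟨k, t, b, hne.symm⟩
  obtain ⟨x, y, hxy⟩ := hnc
  set p := ∑ i : Fin k ↪ g.V, ρe (∑ c, t c * g.adjTensor (i ∘ c) + b)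
  set q := ∑ i : Fin k ↪ h.V, ρe (∑ c, t c * h.adjTensor (i ∘ c) + b)
  have hpq : p - q ≠ 0 := sub_ne_zero.2 hne
  -- Slope of the affine map sending `p` to `x` and `q` to `y`, two points that `ρi` distinguishes.
  set a := (x - y) / (p - q)
  refine ⟨⟨k, tieParams t b, botParams k a (x - a * p)⟩, ?_⟩
  have hval : ∀ g : AttrGraph 𝒜,
      feature ρi ρe g ⟨k, tieParams t b, botParams k a (x - a * p)⟩
        = ρi (a * ∑ i : Fin k ↪ g.V, ρe (∑ c, t c * g.adjTensor (i ∘ c) + b) + (x - a * p)) := by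
    intro g
    refine congrArg ρi ((affInv_botParams _ _ _).trans ?_)
    congr 2
    refine Finset.sum_congr rfl fun i _ => congrArg ρe ?_
    exact affEquiv_tieParams t b g.adjTensor i.injective
  rw [hval g, hval h]
  have hx : a * p + (x - a * p) = x := by ring
  have hy : a * q + (x - a * p) = y := by
    have : a * (p - q) = x - y := div_mul_cancel₀ _ hpq
    linarith
  change ρi (a * p + (x - a * p)) ≠ ρi (a * q + (x - a * p))
  rwa [hx, hy]

/-! ### Continuity and integrability of the features -/

theorem continuous_feature {ρi ρe : ℝ → ℝ} (hρi : Continuous ρi) (hρe : Continuous ρe)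
    (g : AttrGraph 𝒜) : Continuous (feature ρi ρe g) := by
  refine continuous_sigma fun k => ?_
  have : Continuous fun θ : EquivParams 2 (k : ℕ) × InvParams (k : ℕ) =>
      ρi (affInv θ.2 fun i => ρe (affEquiv θ.1 g.adjTensor i)) := by
    unfold affInv affEquiv invMap
    fun_prop
  exact this

theorem memLp_feature {ρi ρe : ℝ → ℝ} (hρi : Continuous ρi) (hρe : Continuous ρe)
    {P : Measure ParamSpace} [IsFiniteMeasure P] {g : AttrGraph 𝒜}
    (hg : Integrable (fun w => feature ρi ρe g w ^ 4) P) : MemLp (feature ρi ρe g) 2 P := by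
  have hm := (continuous_feature hρi hρe g).measurable
  rw [memLp_two_iff_integrable_sq hm.aestronglyMeasurable]
  refine (hg.add (integrable_const 1)).mono' (hm.pow_const 2).aestronglyMeasurable
    (ae_of_all _ fun w => ?_)
  rw [Real.norm_of_nonneg (sq_nonneg _)]
  change feature ρi ρe g w ^ 2 ≤ feature ρi ρe g w ^ 4 + 1
  -- `s⁴ - s² + 1 = (s² - 1)² + s²`.
  nlinarith [sq_nonneg (feature ρi ρe g w ^ 2 - 1), sq_nonneg (feature ρi ρe g w)]

theorem dist_toLp_eq_sqrt_integral {α : Type*} [MeasurableSpace α] {μ : Measure α} {f g : α → ℝ}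
    (hf : MemLp f 2 μ) (hg : MemLp g 2 μ) :
    dist (hf.toLp f) (hg.toLp g) = √(∫ x, (f x - g x) ^ 2 ∂μ) := by
  rw [dist_eq_norm, ← MemLp.toLp_sub, Lp.norm_toLp,
    (hf.sub hg).eLpNorm_eq_integral_rpow_norm two_ne_zero ENNReal.ofNat_ne_top,
    ENNReal.toReal_ofReal (by positivity), Real.sqrt_eq_rpow]
  simp

/-- The set where two continuous features differ is open, so if nonempty it has positive measure. -/
theorem feature_eq_of_ae_eq {ρi ρe : ℝ → ℝ} (hρi : Continuous ρi) (hρe : Continuous ρe)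
    {P : Measure ParamSpace} (hsupp : P.support = Set.univ) {g h : AttrGraph 𝒜}
    (hae : feature ρi ρe g =ᵐ[P] feature ρi ρe h) : feature ρi ρe g = feature ρi ρe h := by
  by_contra hne
  obtain ⟨w, hw⟩ := Function.ne_iff.1 hne
  have hopen : IsOpen {w | feature ρi ρe g w ≠ feature ρi ρe h w} :=
    isOpen_ne_fun (continuous_feature hρi hρe g) (continuous_feature hρi hρe h)
  have hmem : w ∈ P.support := hsupp ▸ Set.mem_univ w
  exact ((Measure.mem_support_iff_forall w).1 hmem _ (hopen.mem_nhds hw)).ne' (ae_iff.1 hae)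

end GRNF

theorem theorem1 (𝒜 : Set ℝ) (ρi ρe : ℝ → ℝ)
    (hρi : Continuous ρi) (hρe : Continuous ρe)
    (hsq : GRNF.IsSquashing ρe) (hnc : ∃ x y, ρi x ≠ ρi y)
    (P : Measure GRNF.ParamSpace) [IsProbabilityMeasure P]
    (hsupp : P.support = Set.univ)
    (hmom : ∃ C : ℝ, 0 < C ∧ ∀ g : GRNF.AttrGraph 𝒜,
      Integrable (fun w => GRNF.feature ρi ρe g w ^ 4) P ∧
        ∫ w, GRNF.feature ρi ρe g w ^ 4 ∂P < C) :
    (∀ g₁ g₂ : GRNF.AttrGraph 𝒜,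
      Integrable (fun w => (GRNF.feature ρi ρe g₁ w - GRNF.feature ρi ρe g₂ w) ^ 2) P) ∧
    (∃ m : MetricSpace (GRNF.GraphSpace 𝒜), ∀ g₁ g₂ : GRNF.AttrGraph 𝒜,
      m.dist (Quotient.mk (GRNF.graphSetoid 𝒜) g₁) (Quotient.mk (GRNF.graphSetoid 𝒜) g₂) =
        GRNF.graphDist ρi ρe P g₁ g₂) ∧
    (∀ g₁ g₂ : GRNF.AttrGraph 𝒜,
      0 < GRNF.graphDist ρi ρe P g₁ g₂ ↔ ¬ GRNF.Isomorphic g₁ g₂) := by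
  obtain ⟨C, -, hC⟩ := hmom
  have hL : ∀ g : GRNF.AttrGraph 𝒜, MemLp (GRNF.feature ρi ρe g) 2 P := fun g =>
    GRNF.memLp_feature hρi hρe (hC g).1
  have hdist : ∀ g₁ g₂ : GRNF.AttrGraph 𝒜,
      dist ((hL g₁).toLp _) ((hL g₂).toLp _) = GRNF.graphDist ρi ρe P g₁ g₂ := fun g₁ g₂ =>
    GRNF.dist_toLp_eq_sqrt_integral (hL g₁) (hL g₂)
  have heq : ∀ g₁ g₂ : GRNF.AttrGraph 𝒜,
      (hL g₁).toLp _ = (hL g₂).toLp _ ↔ GRNF.Isomorphic g₁ g₂ := by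
    intro g₁ g₂
    rw [MemLp.toLp_eq_toLp_iff]
    refine ⟨fun hae => ?_, fun H => (GRNF.feature_eq_of_isomorphic ρi ρe H).eventuallyEq⟩
    by_contra hiso
    obtain ⟨w, hw⟩ := GRNF.exists_feature_ne hsq hnc hiso
    exact hw (congrFun (GRNF.feature_eq_of_ae_eq hρi hρe hsupp hae) w)
  refine ⟨fun g₁ g₂ => ((hL g₁).sub (hL g₂)).integrable_sq, ?_, fun g₁ g₂ => ?_⟩
  · let Φ : GRNF.GraphSpace 𝒜 → Lp ℝ 2 P :=
      Quotient.lift (fun g => (hL g).toLp _) fun g₁ g₂ H => (heq g₁ g₂).2 H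
    have hΦ : Function.Injective Φ := by
      intro a b
      induction a using Quotient.inductionOn
      induction b using Quotient.inductionOn
      exact fun h => Quotient.sound ((heq _ _).1 h)
    exact ⟨MetricSpace.induced Φ hΦ inferInstance, hdist⟩
  · rw [← hdist, dist_pos, Ne, heq]
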